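/- Consider the Poisson bipolar network with ALOHA and Rayleigh fading and unit link distance. Let $\alpha>2$ be the path loss exponent and $\delta=2/\alpha\in(0,1)$. For $\lambda>0$ and $p\in(0,1]$, the potential interferers form a homogeneous Poisson point process $\Phi=\{x_n\}_{n\ge 1}\subset\mathbb{R}^2$ of density $\lambda$; each of them is active independently with probability $p$ (indicators $B_n$); the channel power gains $h_0,h_1,h_2,\dots$ are i.i.d. exponential with mean $1$; and $\Phi$, $(B_n)$ and $(h_n)$ are independent. The typical link consists of an additional active transmitter at $(1,0)$ and its receiver at the origin, with $$\mathsf{SIR}=\frac{h_0}{\sum_{n\ge 1} B_n h_n\|x_n\|^{-\alpha}} .$$ For $\theta>0$ and $\epsilon\in(0,1)$ let $P_{\rm s}(\theta)=\mathbb{P}(\mathsf{SIR}>\theta\mid\Phi)$ be the conditional link success probability, $\eta(\theta,\epsilon)=\mathbb{P}(P_{\rm s}(\theta)>1-\epsilon)$ the meta distribution of the SIR, and $$S(\theta,\epsilon)=\sup_{\lambda>0,\;p\in(0,1]}\lambda\,p\,\eta(\theta,\epsilon)$$ the spatial outage capacity. Then, for all $\alpha>2$, $\theta>0$ and $\epsilon\in(0,1)$,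 $$S(\theta,\epsilon) > \left(\frac{1-W((1-\epsilon)e)}{\pi\theta^{\delta}\,\Gamma(1+\delta)\,\Gamma(1-\delta)}\right)\left(\frac{e^{-(1-W((1-\epsilon)e))}-(1-\epsilon)}{\epsilon}\right),$$ where $W$ denotes the (principal branch of the) Lambert $W$ function, the inverse of $w\mapsto we^w$ on $[-1,\infty)$. -/

import Mathlib

open MeasureTheory ProbabilityTheory
open scoped ENNReal

universe u

noncomputable section

/-- The Euclidean plane. -/
abbrev Plane : Type := EuclideanSpace ℝ (Fin 2)

/-- The random counting measure `Φ = ∑ₙ δ_{Xₙ}` of an enumerated point process. -/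
def countingMeasure {Ω : Type*} (X : ℕ → Ω → Plane) (ω : Ω) : Measure Plane :=
  Measure.sum fun n => Measure.dirac (X n ω)

/-- `X` enumerates the points of a homogeneous Poisson point process in the plane of density
`lam`: the number of points in a Borel set `S` of finite area is Poisson with mean `lam * |S|`,
and the numbers of points in finitely many pairwise disjoint Borel sets are independent.
(For `lam > 0` such a process has infinitely many points almost surely, so that an enumeration
by the natural numbers is available.) -/
structure IsHomogeneousPPP {Ω : Type*} [MeasurableSpace Ω] (lam : ℝ) (X : ℕ → Ω → Plane)
    (P : Measure Ω) : Prop where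
  measurable : ∀ n, Measurable (X n)
  count_law : ∀ S : Set Plane, MeasurableSet S → volume S ≠ ∞ →
    HasLaw (fun ω => countingMeasure X ω S)
      ((poissonMeasure (lam * volume.real S).toNNReal).map (fun k : ℕ => (k : ℝ≥0∞))) P
  count_indep : ∀ (m : ℕ) (S : Fin m → Set Plane), (∀ i, MeasurableSet (S i)) →
    (∀ i j, i ≠ j → Disjoint (S i) (S j)) →
    iIndepFun (fun i ω => countingMeasure X ω (S i)) P

/-- A Poisson bipolar network with ALOHA and Rayleigh fading, seen from the typical link, in one
time slot: potential transmitter density `lam`, transmit probability `p`. The receivers of the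
other links play no role for the typical link and are not recorded. -/
structure BipolarNetwork (lam p : ℝ) where
  /-- The sample space. -/
  Ω : Type u
  /-- The events. -/
  events : MeasurableSpace Ω
  /-- The probability measure. -/
  P : Measure Ω
  isProb : IsProbabilityMeasure P
  /-- The locations of the potential interferers. -/
  X : ℕ → Ω → Plane
  /-- Channel power gains to the typical receiver: `none` is the desired transmitter, `some n` is
  the interferer at `X n`. -/
  h : Option ℕ → Ω → ℝ
  /-- ALOHA: whether the node at `X n` transmits. -/
  active : ℕ → Ω → Bool
  ppp : IsHomogeneousPPP lam X P
  measurable_h : ∀ i, Measurable (h i)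
  measurable_active : ∀ n, Measurable (active n)
  law_h : ∀ i, HasLaw (h i) (expMeasure 1) P
  law_active : ∀ n, P {ω | active n ω = true} = ENNReal.ofReal p
  indep_h : iIndepFun h P
  indep_active : iIndepFun active P
  /-- The fading is independent of the ALOHA decisions, ... -/
  indep_h_active : IndepFun (fun ω i => h i ω) (fun ω n => active n ω) P
  /-- ... and both are jointly independent of the point process. -/
  indep_X : IndepFun (fun ω n => X n ω)
    (fun ω => ((fun i => h i ω, fun n => active n ω) : (Option ℕ → ℝ) × (ℕ → Bool))) P

attribute [instance] BipolarNetwork.events BipolarNetwork.isProb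

/-- Power law path loss `‖x - y‖ ^ (-α)`. -/
def pathLoss (α : ℝ) (x y : Plane) : ℝ≥0∞ := edist x y ^ (-α)

namespace BipolarNetwork

variable {lam p : ℝ} (N : BipolarNetwork lam p)

/-- The interference at the origin, all nodes transmitting at unit power. -/
def interference (α : ℝ) (ω : N.Ω) : ℝ≥0∞ :=
  ∑' n, if N.active n ω = true then
    ENNReal.ofReal (N.h (some n) ω) * pathLoss α (N.X n ω) 0 else 0

/-- The SIR of the typical link: an active transmitter is added at `(R, 0)`, and its receiver is
at the origin. -/
def sir (α R : ℝ) (ω : N.Ω) : ℝ≥0∞ :=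
  ENNReal.ofReal (N.h none ω) * pathLoss α !₂[R, 0] 0 / N.interference α ω

/-- The σ-algebra generated by the point process `Φ` (as a random measure). -/
abbrev sigmaPhi : MeasurableSpace N.Ω :=
  MeasurableSpace.comap (countingMeasure N.X) inferInstance

/-- The conditional link success probability `P(SIR > θ | Φ)`. -/
def condSuccess (α R θ : ℝ) : N.Ω → ℝ :=
  N.P⟦{ω | ENNReal.ofReal θ < N.sir α R ω} | N.sigmaPhi⟧

/-- The meta distribution `η(θ, ε) = P(P(SIR > θ | Φ) > 1 - ε)` of the SIR. -/
def metaDistribution (α R θ ε : ℝ) : ℝ :=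
  N.P.real {ω | 1 - ε < N.condSuccess α R θ ω}

end BipolarNetwork

/-- The pairs `(lam, p)` with `lam > 0` and `p ∈ (0, 1]`. -/
abbrev NetworkParams : Type := {q : ℝ × ℝ // 0 < q.1 ∧ 0 < q.2 ∧ q.2 ≤ 1}

/-- The spatial outage capacity: the supremum over `lam > 0` and `p ∈ (0, 1]` of
`lam * p * η(θ, ε)`, where `N q` is a bipolar network with parameters `q = (lam, p)`. The
supremum is taken in the extended reals, so that it needs no boundedness. -/
def spatialOutageCapacity (N : ∀ q : NetworkParams, BipolarNetwork.{u} q.1.1 q.1.2)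
    (α R θ ε : ℝ) : EReal :=
  ⨆ q : NetworkParams, ((q.1.1 * q.1.2 * (N q).metaDistribution α R θ ε : ℝ) : EReal)

/-- The principal branch of the Lambert `W` function: the inverse of `w ↦ w * exp w` on
`[-1, ∞)`. -/
def lambertW (x : ℝ) : ℝ := Function.invFunOn (fun w : ℝ => w * Real.exp w) (Set.Ici (-1)) x

end

/-!
The bound comes from the reverse Markov inequality for the conditional success probability
`Pₛ = P(SIR > θ | Φ)`. As `Pₛ ≤ 1`, the meta distribution `η = P(Pₛ > 1 - ε)` satisfies
`E Pₛ ≤ (1 - ε) + ε η`. The mean is `E Pₛ = P(SIR > θ)`, which for a Poisson network with Rayleigh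
fading is at least `exp (-λ C)`, where `C = π θ ^ δ Γ(1 + δ) Γ(1 - δ)`. Hence
`λ η ≥ λ (exp (-λ C) - (1 - ε)) / ε` with `p = 1`. The right-hand side is maximal where
`w = 1 - λ C` solves `w eʷ = (1 - ε) e`, and its value at `λ = (1 - W((1 - ε) e)) / C` is the claimed
bound. A single pair of parameters therefore suffices, provided that the reverse Markov inequality
is strict there (`integral_lt_add_mul_measureReal`). It is, because the bound makes `η` positive
and `Pₛ < 1` almost surely (`BipolarNetwork.condSuccess_lt_one`): conditionally on `Φ`, the desired
gain is with positive probability too small compared with the gain of one interferer.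

The mean (`BipolarNetwork.exp_le_measure_success`) is bounded from below in three steps. For fixed
interferer positions, the exponential tail of the desired gain and the Laplace transform of the
other gains give `∏ (1 + θ ‖xₙ‖ ^ (-α))⁻¹` (`expNeg_tsum_logOneAdd_le_measure`). This product is
`exp (-∑ g(xₙ))` with `g = log (1 + θ ‖·‖ ^ (-α))`, and the Laplace functional of the Poisson
process bounds its expectation below by `exp (-λ ∫ (1 - e ^ (-g)))`
(`IsHomogeneousPPP.expNeg_le_lintegral`). The last integral is `C`
(`lintegral_one_sub_inv_one_add_pathLoss`). Only lower bounds are needed, so that each limit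
passage goes in one direction. All sums and integrals take values in `[0, ∞]`, and
`expNeg` is the exponential `t ↦ e⁻ᵗ` there.
-/

/-! ### The exponential function `t ↦ e⁻ᵗ` on `[0, ∞]` -/

/-- The function `t ↦ e⁻ᵗ` on `[0, ∞]`, with `e⁻^∞ = 0`. -/
noncomputable def expNeg (t : ℝ≥0∞) : ℝ≥0∞ := EReal.exp (-(t : EReal))

theorem expNeg_ofReal {x : ℝ} (hx : 0 ≤ x) :
    expNeg (ENNReal.ofReal x) = ENNReal.ofReal (Real.exp (-x)) := by
  rw [expNeg, EReal.coe_ennreal_ofReal, max_eq_left hx, ← EReal.coe_neg, EReal.exp_coe]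

@[simp] theorem expNeg_zero : expNeg 0 = 1 := by simp [expNeg]

@[simp] theorem expNeg_top : expNeg ⊤ = 0 := by simp [expNeg]

theorem expNeg_add (s t : ℝ≥0∞) : expNeg (s + t) = expNeg s * expNeg t := by
  unfold expNeg
  rw [EReal.coe_ennreal_add, EReal.exp_neg, EReal.exp_add, EReal.exp_neg, EReal.exp_neg,
    ENNReal.mul_inv]
  · left; simp
  · right; simp

theorem expNeg_sum {ι : Type*} (s : Finset ι) (f : ι → ℝ≥0∞) :
    expNeg (∑ i ∈ s, f i) = ∏ i ∈ s, expNeg (f i) := by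
  induction s using Finset.cons_induction with
  | empty => simp
  | cons a s ha ih => simp [expNeg_add, ih]

theorem antitone_expNeg : Antitone expNeg := fun s t h => by
  unfold expNeg
  simpa using h

theorem continuous_expNeg : Continuous expNeg :=
  ENNReal.continuous_exp.comp (continuous_neg.comp continuous_coe_ennreal_ereal)

@[fun_prop] theorem measurable_expNeg : Measurable expNeg := continuous_expNeg.measurable

theorem expNeg_le_one (t : ℝ≥0∞) : expNeg t ≤ 1 := by
  simpa using antitone_expNeg (zero_le (a := t))

/-! ### Exponential gains -/

/-- The Laplace transform of the unit exponential law. -/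
theorem lintegral_expNeg_mul_expMeasure {a : ℝ≥0∞} (ha : a ≠ ⊤) :
    ∫⁻ x, expNeg (a * ENNReal.ofReal x) ∂expMeasure 1 = (1 + a)⁻¹ := by
  lift a to NNReal using ha
  have hpos : (0 : ℝ) < 1 + a := by positivity
  have key : ∀ x : ℝ, exponentialPDF 1 x * expNeg (a * ENNReal.ofReal x)
      = ENNReal.ofReal ((1 + a)⁻¹) * exponentialPDF (1 + a) x := by
    intro x
    rcases lt_or_ge x 0 with hx | hx
    · simp [exponentialPDF_of_neg hx]
    · have : (a : ℝ≥0∞) * ENNReal.ofReal x = ENNReal.ofReal (a * x) := by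
        rw [ENNReal.ofReal_mul a.coe_nonneg, ENNReal.ofReal_coe_nnreal]
      rw [this, expNeg_ofReal (by positivity), exponentialPDF_of_nonneg hx,
        exponentialPDF_of_nonneg hx, ← ENNReal.ofReal_mul (by positivity),
        ← ENNReal.ofReal_mul (by positivity), inv_mul_cancel_left₀ hpos.ne', one_mul, one_mul,
        ← Real.exp_add]
      ring_nf
  have hm : Measurable (exponentialPDF 1) := (measurable_exponentialPDFReal 1).ennreal_ofReal
  have hm' : Measurable (exponentialPDF (1 + a)) :=
    (measurable_exponentialPDFReal _).ennreal_ofReal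
  change ∫⁻ x, _ ∂(volume.withDensity (exponentialPDF 1)) = _
  rw [lintegral_withDensity_eq_lintegral_mul _ hm (by fun_prop)]
  simp only [Pi.mul_apply, key]
  rw [lintegral_const_mul _ hm', lintegral_exponentialPDF_eq_one hpos, mul_one,
    ENNReal.ofReal_inv_of_pos hpos, ENNReal.ofReal_add zero_le_one a.coe_nonneg]
  simp

/-- The tail function of the unit exponential law. -/
theorem expMeasure_lt_ofReal (s : ℝ≥0∞) :
    expMeasure 1 {x | s < ENNReal.ofReal x} = expNeg s := by
  have := isProbabilityMeasure_expMeasure one_pos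
  induction s with
  | top => simp
  | coe s =>
    have h1 : {x : ℝ | (s : ℝ≥0∞) < ENNReal.ofReal x} = (Set.Iic (s : ℝ))ᶜ := by
      ext x
      rw [Set.mem_ofPred_eq, ← ENNReal.ofReal_coe_nnreal, ENNReal.ofReal_lt_ofReal_iff_of_nonneg
        s.coe_nonneg]
      simp
    have h2 : (expMeasure 1).real (Set.Iic (s : ℝ)) = 1 - Real.exp (-s) := by
      rw [← cdf_eq_real, cdf_expMeasure_eq one_pos, if_pos s.coe_nonneg, one_mul]
    rw [h1, ← ENNReal.ofReal_coe_nnreal, expNeg_ofReal s.coe_nonneg,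
      ← ofReal_measureReal, probReal_compl_eq_one_sub measurableSet_Iic, h2]
    simp

/-- The function `a ↦ log (1 + a)` on `[0, ∞]`. -/
noncomputable def logOneAdd (a : ℝ≥0∞) : ℝ≥0∞ := (ENNReal.log (1 + a)).toENNReal

theorem expNeg_logOneAdd (a : ℝ≥0∞) : expNeg (logOneAdd a) = (1 + a)⁻¹ := by
  have h : 0 ≤ ENNReal.log (1 + a) := by simp
  rw [logOneAdd, expNeg, EReal.coe_toENNReal h, EReal.exp_neg, ENNReal.exp_log]

@[fun_prop] theorem measurable_logOneAdd : Measurable logOneAdd :=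
  (ENNReal.measurable_log.comp (measurable_const.add measurable_id)).ereal_toENNReal

theorem measurable_tsum_mul_ofReal {Ω : Type*} {_ : MeasurableSpace Ω} (a : ℕ → ℝ≥0∞)
    {h : ℕ → Ω → ℝ} (hm : ∀ n, Measurable (h n)) :
    Measurable fun ω => ∑' n, a n * ENNReal.ofReal (h n ω) :=
  Measurable.tsum fun n => measurable_const.mul (hm n).ennreal_ofReal

/-- For independent unit exponential gains, a weighted sum of interfering gains stays below the
gain of the desired link with probability at least `∏ (1 + aₙ)⁻¹`. -/
theorem expNeg_tsum_logOneAdd_le_measure {Ω : Type*} [MeasurableSpace Ω] {P : Measure Ω}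
    [IsProbabilityMeasure P] {h : Option ℕ → Ω → ℝ} (hm : ∀ i, Measurable (h i))
    (law : ∀ i, HasLaw (h i) (expMeasure 1) P) (indep : iIndepFun h P) (a : ℕ → ℝ≥0∞) :
    expNeg (∑' n, logOneAdd (a n)) ≤
      P {ω | ∑' n, a n * ENNReal.ofReal (h (some n) ω) < ENNReal.ofReal (h none ω)} := by
  -- An infinite weight makes the left-hand side vanish.
  by_cases ha : ∃ n, a n = ⊤
  · obtain ⟨n, hn⟩ := ha
    have h1 : logOneAdd (a n) = ⊤ := by simp [logOneAdd, hn]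
    rw [ENNReal.tsum_eq_top_of_eq_top ⟨n, h1⟩]
    simp
  push Not at ha
  have hprob := isProbabilityMeasure_expMeasure one_pos
  set S : Ω → ℝ≥0∞ := fun ω => ∑' n, a n * ENNReal.ofReal (h (some n) ω) with hS
  have hSm : Measurable S := measurable_tsum_mul_ofReal a fun n => hm _
  have hind : IndepFun S (h none) P := by
    have h1 : Indep (⨆ i ∈ Set.range some, MeasurableSpace.comap (h i) inferInstance)
        (⨆ i ∈ ({none} : Set (Option ℕ)), MeasurableSpace.comap (h i) inferInstance) P := by
      refine indep_iSup_of_disjoint (fun i => (hm i).comap_le) indep ?_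
      simp [Set.disjoint_left]
    refine indep_of_indep_of_le_left (indep_of_indep_of_le_right h1 ?_) ?_
    · exact le_iSup₂_of_le none rfl le_rfl
    · rw [← measurable_iff_comap_le]
      refine measurable_tsum_mul_ofReal a fun n => ?_
      rw [measurable_iff_comap_le]
      exact le_iSup₂_of_le (some n) ⟨n, rfl⟩ le_rfl
  have step1 : P {ω | S ω < ENNReal.ofReal (h none ω)} = ∫⁻ ω, expNeg (S ω) ∂P := by
    have hE : MeasurableSet {q : ℝ≥0∞ × ℝ | q.1 < ENNReal.ofReal q.2} :=
      measurableSet_lt measurable_fst measurable_snd.ennreal_ofReal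
    have h1 := (indepFun_iff_map_prod_eq_prod_map_map hSm.aemeasurable
      (hm none).aemeasurable).1 hind
    have h2 : P {ω | S ω < ENNReal.ofReal (h none ω)}
        = P.map (fun ω => (S ω, h none ω)) {q | q.1 < ENNReal.ofReal q.2} := by
      rw [Measure.map_apply (hSm.prodMk (hm none)) hE]; rfl
    rw [h2, h1, (law none).map_eq, Measure.prod_apply hE,
      lintegral_map (measurable_measure_prodMk_left hE) hSm]
    refine lintegral_congr fun ω => ?_
    exact expMeasure_lt_ofReal (S ω)
  have fin : ∀ N : ℕ, expNeg (∑' n, logOneAdd (a n)) ≤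
      ∫⁻ ω, expNeg (∑ n ∈ Finset.range N, a n * ENNReal.ofReal (h (some n) ω)) ∂P := by
    intro N
    have hi : iIndepFun (fun n ω => expNeg (a n * ENNReal.ofReal (h (some n) ω))) P :=
      (indep.precomp (Option.some_injective ℕ)).comp
        (fun n x => expNeg (a n * ENNReal.ofReal x)) fun n => by fun_prop
    simp only [expNeg_sum]
    rw [lintegral_prod_eq_prod_lintegral_of_indepFun _ _ hi fun n =>
      measurable_expNeg.comp (measurable_const.mul (hm _).ennreal_ofReal)]
    have h3 : ∀ n, ∫⁻ ω, expNeg (a n * ENNReal.ofReal (h (some n) ω)) ∂P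
        = expNeg (logOneAdd (a n)) := by
      intro n
      rw [expNeg_logOneAdd, ← lintegral_expNeg_mul_expMeasure (ha n), ← (law (some n)).map_eq,
        lintegral_map (by fun_prop) (hm _)]
    simp only [h3]
    rw [← expNeg_sum]
    exact antitone_expNeg (ENNReal.sum_le_tsum _)
  rw [step1]
  refine ge_of_tendsto' (x := Filter.atTop) (tendsto_lintegral_of_dominated_convergence
    (fun _ => 1) (fun N => ?_) (fun N => ?_) (by simp) ?_) fin
  · exact measurable_expNeg.comp (Finset.measurable_sum _ fun n _ =>
      measurable_const.mul (hm _).ennreal_ofReal)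
  · exact Filter.Eventually.of_forall fun ω => expNeg_le_one _
  · exact Filter.Eventually.of_forall fun ω =>
      (continuous_expNeg.tendsto _).comp (ENNReal.tendsto_nat_tsum _)

/-! ### The Laplace functional of a Poisson process -/

/-- The Laplace transform of the Poisson law. -/
theorem lintegral_expNeg_mul_poissonMeasure (r : NNReal) (c : NNReal) :
    ∫⁻ k : ℕ, expNeg (c * k) ∂poissonMeasure r = expNeg (r * (1 - expNeg c)) := by
  have h1 : ∀ k : ℕ, expNeg (c * k) = ENNReal.ofReal (Real.exp (-c) ^ k) := by
    intro k
    have : (c : ℝ≥0∞) * k = ENNReal.ofReal (c * k) := by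
      rw [ENNReal.ofReal_mul c.coe_nonneg]; simp
    rw [this, expNeg_ofReal (by positivity), ← Real.exp_nat_mul]
    ring_nf
  have hle : Real.exp (-(c : ℝ)) ≤ 1 := by simp
  have h2 : (r : ℝ≥0∞) * (1 - expNeg c) = ENNReal.ofReal (r * (1 - Real.exp (-c))) := by
    rw [← ENNReal.ofReal_coe_nnreal, ← ENNReal.ofReal_coe_nnreal, expNeg_ofReal c.coe_nonneg,
      ← ENNReal.ofReal_one, ← ENNReal.ofReal_sub _ (Real.exp_pos _).le,
      ← ENNReal.ofReal_mul r.coe_nonneg]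
  rw [h2, expNeg_ofReal (mul_nonneg r.coe_nonneg (by linarith)), lintegral_countable']
  have h3 : ∀ k : ℕ, expNeg (c * k) * poissonMeasure r {k} = ENNReal.ofReal
      (Real.exp (-r) * ((r * Real.exp (-c)) ^ k / k.factorial)) := by
    intro k
    rw [h1, poissonMeasure_singleton, ← ENNReal.ofReal_mul (by positivity)]
    congr 1
    rw [mul_pow]
    ring
  simp only [h3]
  have hs := (NormedSpace.expSeries_div_hasSum_exp ((r : ℝ) * Real.exp (-c))).mul_left
    (Real.exp (-r))
  rw [← ENNReal.ofReal_tsum_of_nonneg (fun k => by positivity) hs.summable, hs.tsum_eq,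
    ← Real.exp_eq_exp_ℝ, ← Real.exp_add]
  ring_nf

theorem measurable_countingMeasure {Ω : Type*} [MeasurableSpace Ω] {X : ℕ → Ω → Plane}
    (hX : ∀ n, Measurable (X n)) : Measurable (countingMeasure X) := by
  refine Measure.measurable_of_measurable_coe _ fun S hS => ?_
  simp only [countingMeasure, Measure.sum_apply _ hS, Measure.dirac_apply' _ hS]
  exact Measurable.tsum fun n => (measurable_one.indicator hS).comp (hX n)

/-- The Laplace functional of a Poisson process at a simple function supported on a set of finite
area. -/
theorem IsHomogeneousPPP.lintegral_expNeg_simpleFunc {Ω : Type*} [MeasurableSpace Ω]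
    {P : Measure Ω} {lam : ℝ} (hlam : 0 ≤ lam) {X : ℕ → Ω → Plane}
    (hX : IsHomogeneousPPP lam X P) (g : SimpleFunc Plane ℝ≥0∞)
    (hg : ∀ x, g x ≠ ⊤) (hfin : ∀ c, c ≠ 0 → volume (g ⁻¹' {c}) ≠ ⊤) :
    ∫⁻ ω, expNeg (∫⁻ x, g x ∂countingMeasure X ω) ∂P
      = expNeg (ENNReal.ofReal lam * ∫⁻ x, (1 - expNeg (g x))) := by
  classical
  set R := g.range.filter (· ≠ 0) with hR
  have hms : ∀ c, MeasurableSet (g ⁻¹' {c}) := fun c => g.measurableSet_fiber c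
  have hcm : ∀ S, MeasurableSet S → Measurable fun ω => countingMeasure X ω S := fun S hS =>
    (Measure.measurable_coe hS).comp (measurable_countingMeasure hX.measurable)
  have e1 : ∀ ω, ∫⁻ x, g x ∂countingMeasure X ω
      = ∑ c ∈ R, c * countingMeasure X ω (g ⁻¹' {c}) := by
    intro ω
    rw [SimpleFunc.lintegral_eq_lintegral, SimpleFunc.lintegral]
    symm
    apply Finset.sum_filter_of_ne
    rintro c - h rfl
    simp at h
  have e2 : ∫⁻ x, (1 - expNeg (g x)) = ∑ c ∈ R, (1 - expNeg c) * volume (g ⁻¹' {c}) := by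
    have : (fun x => 1 - expNeg (g x)) = ⇑(g.map fun c => 1 - expNeg c) := by
      ext x; simp
    rw [this, SimpleFunc.lintegral_eq_lintegral, SimpleFunc.map_lintegral]
    symm
    apply Finset.sum_filter_of_ne
    rintro c - h rfl
    simp at h
  -- The independence hypothesis is indexed by `Fin m`, so it is transported to the value set.
  have hind : iIndepFun (fun (c : R) ω => countingMeasure X ω (g ⁻¹' {(c : ℝ≥0∞)})) P := by
    have h := hX.count_indep R.card (fun i => g ⁻¹' {(R.equivFin.symm i : ℝ≥0∞)})
      (fun i => hms _) (fun i j hij => by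
        refine Disjoint.preimage _ ?_
        rw [Set.disjoint_singleton]
        exact fun h => hij (R.equivFin.symm.injective (Subtype.ext h)))
    have h' := h.precomp R.equivFin.injective
    simpa [Function.comp_def] using h'
  have hcomp : iIndepFun (fun (c : R) ω =>
      expNeg (c * countingMeasure X ω (g ⁻¹' {(c : ℝ≥0∞)}))) P :=
    hind.comp (fun c t => expNeg (c * t)) fun c => by fun_prop
  have hone : ∀ c : R, ∫⁻ ω, expNeg (c * countingMeasure X ω (g ⁻¹' {(c : ℝ≥0∞)})) ∂P
      = expNeg (ENNReal.ofReal lam * ((1 - expNeg c) * volume (g ⁻¹' {(c : ℝ≥0∞)}))) := by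
    rintro ⟨c, hc⟩
    obtain ⟨hcr, hc0⟩ := Finset.mem_filter.1 hc
    obtain ⟨x, rfl⟩ := SimpleFunc.mem_range.1 hcr
    have hv := hfin _ hc0
    have law := hX.count_law _ (hms (g x)) hv
    have hvol : ((lam * volume.real (g ⁻¹' {g x})).toNNReal : ℝ≥0∞)
        = ENNReal.ofReal lam * volume (g ⁻¹' {g x}) := by
      change ENNReal.ofReal _ = _
      rw [ENNReal.ofReal_mul hlam, ofReal_measureReal hv]
    have hlift := ENNReal.coe_toNNReal (hg x)
    have h1 : ∫⁻ ω, expNeg (g x * countingMeasure X ω (g ⁻¹' {g x})) ∂P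
        = ∫⁻ t, expNeg (g x * t) ∂(P.map fun ω => countingMeasure X ω (g ⁻¹' {g x})) := by
      rw [lintegral_map (by fun_prop) (hcm _ (hms _))]
    change ∫⁻ ω, expNeg (g x * countingMeasure X ω (g ⁻¹' {g x})) ∂P
      = expNeg (ENNReal.ofReal lam * ((1 - expNeg (g x)) * volume (g ⁻¹' {g x})))
    rw [h1, law.map_eq, lintegral_map (by fun_prop) (by fun_prop)]
    have h2 := lintegral_expNeg_mul_poissonMeasure
      (lam * volume.real (g ⁻¹' {g x})).toNNReal (g x).toNNReal
    rw [hlift, hvol] at h2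
    rw [h2]
    ring_nf
  simp only [e1, expNeg_sum]
  have e3 : ∀ ω, ∏ c ∈ R, expNeg (c * countingMeasure X ω (g ⁻¹' {c}))
      = ∏ c : R, expNeg (c * countingMeasure X ω (g ⁻¹' {(c : ℝ≥0∞)})) := fun ω =>
    (Finset.prod_coe_sort R fun c => expNeg (c * countingMeasure X ω (g ⁻¹' {c}))).symm
  simp only [e3]
  rw [lintegral_prod_eq_prod_lintegral_of_indepFun _ _ hcomp fun c =>
    measurable_expNeg.comp (measurable_const.mul (hcm _ (hms _)))]
  simp only [hone]
  rw [← expNeg_sum, e2, Finset.mul_sum]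
  congr 1
  exact Finset.sum_coe_sort R fun c =>
    ENNReal.ofReal lam * ((1 - expNeg c) * volume (g ⁻¹' {c}))

/-- The Laplace functional of a Poisson process; the bound from below is obtained by approximating
the test function from below by simple functions supported in balls. -/
theorem IsHomogeneousPPP.expNeg_le_lintegral {Ω : Type*} [MeasurableSpace Ω]
    {P : Measure Ω} [IsProbabilityMeasure P] {lam : ℝ} (hlam : 0 ≤ lam) {X : ℕ → Ω → Plane}
    (hX : IsHomogeneousPPP lam X P) {g : Plane → ℝ≥0∞} (hg : Measurable g) :
    expNeg (ENNReal.ofReal lam * ∫⁻ x, (1 - expNeg (g x)))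
      ≤ ∫⁻ ω, expNeg (∫⁻ x, g x ∂countingMeasure X ω) ∂P := by
  set B : ℕ → Set Plane := fun n => Metric.closedBall 0 n
  have hB : ∀ n, MeasurableSet (B n) := fun n => measurableSet_closedBall
  set f : ℕ → SimpleFunc Plane ℝ≥0∞ := fun n => (SimpleFunc.eapprox g n).restrict (B n) with hf
  have hfa : ∀ n x, f n x = (B n).indicator (SimpleFunc.eapprox g n) x := fun n x => by
    rw [hf, SimpleFunc.restrict_apply _ (hB n)]
  have hle : ∀ n x, f n x ≤ g x := by
    intro n x
    rw [hfa, ← SimpleFunc.iSup_eapprox_apply hg x]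
    exact (Set.indicator_le_self _ _ _).trans (le_iSup (fun n => SimpleFunc.eapprox g n x) n)
  have hmono : ∀ x, Monotone fun n => f n x := by
    intro x m n hmn
    simp only [hfa]
    refine (Set.indicator_le_indicator_of_subset (Metric.closedBall_subset_closedBall
      (Nat.cast_le.2 hmn)) (fun _ => zero_le) x).trans ?_
    exact Set.indicator_le_indicator (SimpleFunc.monotone_eapprox g hmn x)
  have htend : ∀ x, Filter.Tendsto (fun n => f n x) Filter.atTop (nhds (g x)) := by
    intro x
    have h1 : Filter.Tendsto (fun n => SimpleFunc.eapprox g n x) Filter.atTop (nhds (g x)) := by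
      rw [← SimpleFunc.iSup_eapprox_apply hg x]
      exact tendsto_atTop_iSup fun m n hmn => SimpleFunc.monotone_eapprox g hmn x
    refine h1.congr' ?_
    obtain ⟨N, hN⟩ := exists_nat_ge ‖x‖
    filter_upwards [Filter.eventually_ge_atTop N] with n hn
    rw [hfa, Set.indicator_of_mem]
    have : (N : ℝ) ≤ n := by exact_mod_cast hn
    simpa [B] using hN.trans this
  have hnt : ∀ n x, f n x ≠ ⊤ := by
    intro n x
    rw [hfa]
    exact ((Set.indicator_le_self _ _ _).trans_lt (SimpleFunc.eapprox_lt_top g n x)).ne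
  have hvol : ∀ n c, c ≠ 0 → volume (f n ⁻¹' {c}) ≠ ⊤ := by
    intro n c hc
    refine ((measure_mono ?_).trans_lt (measure_closedBall_lt_top (x := (0 : Plane))
      (r := (n : ℝ)))).ne
    intro x hx
    by_contra hxB
    have : f n x = c := hx
    rw [hfa, Set.indicator_of_notMem hxB] at this
    exact hc this.symm
  have hcm := measurable_countingMeasure hX.measurable
  refine ge_of_tendsto' (x := Filter.atTop) (tendsto_lintegral_of_dominated_convergence
    (F := fun n ω => expNeg (∫⁻ x, f n x ∂countingMeasure X ω))
    (fun _ => 1) (fun N => ?_) (fun N => ?_) (by simp) ?_) fun n => ?_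
  · exact measurable_expNeg.comp ((Measure.measurable_lintegral (f N).measurable).comp hcm)
  · exact Filter.Eventually.of_forall fun ω => expNeg_le_one _
  · refine Filter.Eventually.of_forall fun ω => (continuous_expNeg.tendsto _).comp ?_
    exact lintegral_tendsto_of_tendsto_of_monotone (fun n => (f n).measurable.aemeasurable)
      (Filter.Eventually.of_forall hmono) (Filter.Eventually.of_forall htend)
  · rw [hX.lintegral_expNeg_simpleFunc hlam (f n) (hnt n) (hvol n)]
    apply antitone_expNeg
    gcongr with x
    exact antitone_expNeg (hle n x)

/-! ### The path loss integral over the plane -/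

/-- The radial stretched exponential integral over the plane. -/
theorem lintegral_plane_exp_neg_mul_rpow {α b : ℝ} (hα : 1 ≤ α) (hb : 0 < b) :
    ∫⁻ x : Plane, ENNReal.ofReal (Real.exp (-(b * ‖x‖ ^ α)))
      = ENNReal.ofReal (Real.pi * b ^ (-2 / α) * Real.Gamma (2 / α + 1)) := by
  have hmp := (Complex.orthonormalBasisOneI.repr).measurePreserving
  have hI := Complex.integral_exp_neg_mul_rpow hα hb
  have hpos : 0 < Real.pi * b ^ (-2 / α) * Real.Gamma (2 / α + 1) := by
    have : 0 < Real.Gamma (2 / α + 1) := Real.Gamma_pos_of_pos (by positivity)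
    positivity
  rw [← hmp.lintegral_comp_emb
    (Complex.orthonormalBasisOneI.repr.toHomeomorph.measurableEmbedding)]
  simp only [LinearIsometryEquiv.norm_map, ← neg_mul]
  rw [← hI, ofReal_integral_eq_lintegral_ofReal]
  · by_contra h
    rw [integral_undef h] at hI
    exact hpos.ne hI
  · exact Filter.Eventually.of_forall fun x => (Real.exp_pos _).le

/-- Writing `1 - (1 + θ ‖x‖ ^ (-α))⁻¹ = (1 + ‖x‖ ^ α / θ)⁻¹` as a Laplace transform of the
exponential law turns the integral over the plane into a Gamma integral. -/
theorem lintegral_one_sub_inv_one_add_pathLoss {α θ : ℝ} (hα : 2 < α) (hθ : 0 < θ) :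
    ∫⁻ x : Plane, (1 - (1 + ENNReal.ofReal θ * pathLoss α x 0)⁻¹)
      = ENNReal.ofReal (Real.pi * θ ^ (2 / α) * Real.Gamma (1 + 2 / α) *
          Real.Gamma (1 - 2 / α)) := by
  have hα0 : 0 < α := by linarith
  have hδ : 2 / α < 1 := by rw [div_lt_one hα0]; exact hα
  have hprob := isProbabilityMeasure_expMeasure one_pos
  -- The origin, where the path loss is infinite, is a null set.
  have key : ∀ x : Plane, x ≠ 0 → 1 - (1 + ENNReal.ofReal θ * pathLoss α x 0)⁻¹
      = ∫⁻ t, ENNReal.ofReal (Real.exp (-(max t 0 / θ * ‖x‖ ^ α))) ∂expMeasure 1 := by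
    intro x hx
    have hn : 0 < ‖x‖ := norm_pos_iff.2 hx
    have hr : 0 < ‖x‖ ^ α := by positivity
    have h1 : pathLoss α x 0 = ENNReal.ofReal (‖x‖ ^ (-α)) := by
      rw [pathLoss, edist_zero_right, ← ofReal_norm, ENNReal.ofReal_rpow_of_pos hn]
    have h2 := lintegral_expNeg_mul_expMeasure (a := ENNReal.ofReal (‖x‖ ^ α / θ))
      ENNReal.ofReal_ne_top
    have h3 : ∀ t : ℝ, ENNReal.ofReal (Real.exp (-(max t 0 / θ * ‖x‖ ^ α)))
        = expNeg (ENNReal.ofReal (‖x‖ ^ α / θ) * ENNReal.ofReal t) := by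
      intro t
      have : ENNReal.ofReal t = ENNReal.ofReal (max t 0) := by simp
      rw [this, ← ENNReal.ofReal_mul (by positivity), expNeg_ofReal (by positivity)]
      congr 3
      ring
    simp only [h3]
    rw [h2, h1, ← ENNReal.ofReal_mul hθ.le, ← ENNReal.ofReal_one,
      ← ENNReal.ofReal_add zero_le_one (by positivity),
      ← ENNReal.ofReal_add zero_le_one (by positivity),
      ← ENNReal.ofReal_inv_of_pos (by positivity), ← ENNReal.ofReal_inv_of_pos (by positivity),
      ← ENNReal.ofReal_sub _ (by positivity), Real.rpow_neg hn.le]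
    congr 1
    field_simp
    ring
  have hne : ∀ᵐ x : Plane, x ≠ 0 := by simp [ae_iff]
  rw [lintegral_congr_ae (hne.mono key), lintegral_lintegral_swap]
  swap
  · refine Measurable.aemeasurable ?_
    fun_prop
  change ∫⁻ t, _ ∂(volume.withDensity (exponentialPDF 1)) = _
  have hm : Measurable (exponentialPDF 1) := (measurable_exponentialPDFReal 1).ennreal_ofReal
  rw [lintegral_withDensity_eq_lintegral_mul_non_measurable₀ _ hm.aemeasurable
    (Filter.Eventually.of_forall fun t => by simp [exponentialPDF])]
  have hG : 0 < Real.Gamma (1 + 2 / α) := Real.Gamma_pos_of_pos (by positivity)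
  set c := Real.pi * θ ^ (2 / α) * Real.Gamma (1 + 2 / α) with hc
  have hc0 : 0 < c := by positivity
  have key2 : ∀ t : ℝ, t ≠ 0 →
      (exponentialPDF 1 * fun t => ∫⁻ x : Plane,
        ENNReal.ofReal (Real.exp (-(max t 0 / θ * ‖x‖ ^ α)))) t
      = (Set.Ioi (0 : ℝ)).indicator (fun t => ENNReal.ofReal c *
        ENNReal.ofReal (Real.exp (-t) * t ^ (1 - 2 / α - 1))) t := by
    intro t ht
    rcases lt_or_gt_of_ne ht with ht | ht
    · rw [Pi.mul_apply, exponentialPDF_of_neg ht, Set.indicator_of_notMem (by simpa using ht.le),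
        zero_mul]
    · rw [Pi.mul_apply, exponentialPDF_of_nonneg ht.le, Set.indicator_of_mem (by simpa using ht),
        max_eq_left ht.le, lintegral_plane_exp_neg_mul_rpow (by linarith) (by positivity),
        ← ENNReal.ofReal_mul (by positivity), ← ENNReal.ofReal_mul hc0.le]
      congr 1
      rw [Real.div_rpow ht.le hθ.le, neg_div, Real.rpow_neg hθ.le, hc, add_comm (2 / α) 1,
        show 1 - 2 / α - 1 = -(2 / α) by ring]
      field_simp
  have ht0 : ∀ᵐ t : ℝ, t ≠ 0 := by simp [ae_iff]
  rw [lintegral_congr_ae (ht0.mono key2), lintegral_indicator measurableSet_Ioi,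
    lintegral_const_mul _ (by fun_prop), ← ofReal_integral_eq_lintegral_ofReal,
    ← Real.Gamma_eq_integral (by linarith), ← ENNReal.ofReal_mul hc0.le]
  · exact Real.GammaIntegral_convergent (by linarith)
  · exact (ae_restrict_iff' measurableSet_Ioi).2 (Filter.Eventually.of_forall fun t ht =>
      mul_nonneg (Real.exp_pos _).le (Real.rpow_nonneg (le_of_lt ht) _))

/-! ### The Lambert function -/

/-- Since `0 < (1 - ε) e < e`, the equation `w eʷ = (1 - ε) e` has a solution `w ≥ -1`, so that
`lambertW` is not a junk value here, and every such solution lies in `(0, 1)`. -/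
theorem lambertW_spec {ε : ℝ} (hε0 : 0 < ε) (hε1 : ε < 1) :
    0 < lambertW ((1 - ε) * Real.exp 1) ∧ lambertW ((1 - ε) * Real.exp 1) < 1 ∧
      lambertW ((1 - ε) * Real.exp 1) * Real.exp (lambertW ((1 - ε) * Real.exp 1))
        = (1 - ε) * Real.exp 1 := by
  have he : 0 < Real.exp 1 := Real.exp_pos 1
  have hpos : 0 < (1 - ε) * Real.exp 1 := mul_pos (by linarith) he
  have hex : ∃ w ∈ Set.Ici (-1 : ℝ), w * Real.exp w = (1 - ε) * Real.exp 1 := by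
    have hc : ContinuousOn (fun w : ℝ => w * Real.exp w) (Set.Icc 0 1) := by fun_prop
    have := intermediate_value_Icc zero_le_one hc
    obtain ⟨w, hw, h⟩ := this ⟨by simpa using hpos.le, by
      simp only [one_mul]; nlinarith⟩
    exact ⟨w, by have := hw.1; simp only [Set.mem_Ici]; linarith, h⟩
  have heq : lambertW ((1 - ε) * Real.exp 1) * Real.exp (lambertW ((1 - ε) * Real.exp 1))
      = (1 - ε) * Real.exp 1 := Function.invFunOn_eq hex
  set w := lambertW ((1 - ε) * Real.exp 1)
  have hw0 : 0 < w := by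
    by_contra h
    have := mul_nonpos_of_nonpos_of_nonneg (not_lt.1 h) (Real.exp_pos w).le
    linarith
  refine ⟨hw0, ?_, heq⟩
  by_contra h
  have h1 : Real.exp 1 ≤ Real.exp w := Real.exp_le_exp.2 (not_lt.1 h)
  nlinarith [not_lt.1 h]

/-! ### The reverse Markov inequality -/

/-- Strict reverse Markov inequality: if `Y < 1` almost surely and `E Y > c`, then
`E Y < c + (1 - c) P(Y > c)`. -/
theorem integral_lt_add_mul_measureReal {Ω : Type*} [MeasurableSpace Ω] {P : Measure Ω}
    [IsProbabilityMeasure P] {Y : Ω → ℝ} (hYm : Measurable Y) (hY : Integrable Y P)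
    (hlt : ∀ᵐ ω ∂P, Y ω < 1) {c : ℝ} (hc : c < ∫ ω, Y ω ∂P) :
    ∫ ω, Y ω ∂P < c + (1 - c) * P.real {ω | c < Y ω} := by
  set A := {ω | c < Y ω} with hA
  have hAm : MeasurableSet A := measurableSet_lt measurable_const hYm
  set Z : Ω → ℝ := fun ω => c + A.indicator (fun _ => 1 - c) ω with hZ
  have hZi : Integrable Z P :=
    (integrable_const c).add ((integrable_const (1 - c)).indicator hAm)
  have hZint : ∫ ω, Z ω ∂P = c + (1 - c) * P.real A := by
    rw [hZ, integral_add (integrable_const c) ((integrable_const (1 - c)).indicator hAm),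
      integral_indicator_const _ hAm]
    simp [mul_comm]
  rw [← hZint]
  have hpt : ∀ᵐ ω ∂P, Y ω ≤ Z ω ∧ (ω ∈ A → Y ω < Z ω) := by
    filter_upwards [hlt] with ω h
    by_cases hω : ω ∈ A
    · have : Z ω = 1 := by simp [hZ, hω]
      rw [this]; exact ⟨h.le, fun _ => h⟩
    · have : Z ω = c := by simp [hZ, hω]
      rw [this]; exact ⟨not_lt.1 hω, fun h => absurd h hω⟩
  refine lt_of_le_of_ne (integral_mono_ae hY hZi (hpt.mono fun _ h => h.1)) fun heq => ?_
  have hae : Y =ᵐ[P] Z :=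
    (integral_eq_iff_of_ae_le hY hZi (hpt.mono fun _ h => h.1)).1 heq
  -- Equality forces `Y ≤ c` almost surely, against `E Y > c`.
  have hYc : ∀ᵐ ω ∂P, Y ω ≤ c := by
    filter_upwards [hpt, hae] with ω h h'
    by_contra hω
    exact (h.2 (not_le.1 hω)).ne h'
  have := integral_mono_ae hY (integrable_const c) hYc
  simp at this
  linarith

/-! ### Success of the typical link -/

namespace BipolarNetwork

variable {lam p : ℝ} (N : BipolarNetwork.{u} lam p)

theorem measurable_pathLoss (α : ℝ) : Measurable fun x : Plane => pathLoss α x 0 := by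
  unfold pathLoss
  fun_prop

theorem pathLoss_unit (α : ℝ) : pathLoss α !₂[1, 0] 0 = 1 := by
  have : ‖(!₂[1, 0] : Plane)‖ = 1 := by simp [EuclideanSpace.norm_eq]
  rw [pathLoss, edist_zero_right, ← ofReal_norm, this]
  simp

theorem measurable_interference (α : ℝ) : Measurable (N.interference α) := by
  refine Measurable.tsum fun n => Measurable.ite ?_ ?_ measurable_const
  · exact N.measurable_active n (measurableSet_singleton true)
  · exact (N.measurable_h _).ennreal_ofReal.mul
      ((measurable_pathLoss α).comp (N.ppp.measurable n))

theorem measurableSet_success (α θ : ℝ) :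
    MeasurableSet {ω | ENNReal.ofReal θ < N.sir α 1 ω} := by
  refine measurableSet_lt measurable_const ?_
  exact ((N.measurable_h _).ennreal_ofReal.mul_const _).div (N.measurable_interference α)

theorem lt_sir_iff {α θ : ℝ} (hθ : 0 < θ) (ω : N.Ω) :
    ENNReal.ofReal θ < N.sir α 1 ω ↔
      ENNReal.ofReal θ * N.interference α ω < ENNReal.ofReal (N.h none ω) := by
  rw [sir, pathLoss_unit, mul_one]
  rcases eq_or_ne (N.interference α ω) ⊤ with h | h
  · simp [h, ENNReal.mul_top, hθ]
  rcases eq_or_ne (N.interference α ω) 0 with h0 | h0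
  · rw [h0, mul_zero]
    rcases eq_or_ne (ENNReal.ofReal (N.h none ω)) 0 with h1 | h1
    · simp [h1]
    · simp [ENNReal.div_zero h1, pos_iff_ne_zero, h1]
  · exact ENNReal.lt_div_iff_mul_lt (Or.inl h0) (Or.inl h)

theorem sigmaPhi_le : N.sigmaPhi ≤ N.events :=
  (measurable_countingMeasure N.ppp.measurable).comap_le

theorem lintegral_logOneAdd_countingMeasure (α θ : ℝ) (ω : N.Ω) :
    ∫⁻ x, logOneAdd (ENNReal.ofReal θ * pathLoss α x 0) ∂countingMeasure N.X ω
      = ∑' n, logOneAdd (ENNReal.ofReal θ * pathLoss α (N.X n ω) 0) := by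
  have hm : Measurable fun x : Plane => logOneAdd (ENNReal.ofReal θ * pathLoss α x 0) :=
    measurable_logOneAdd.comp (measurable_const.mul (measurable_pathLoss α))
  rw [countingMeasure, lintegral_sum_measure]
  simp only [lintegral_dirac' _ hm]

/-- The success probability is at least its value when every node transmits. -/
theorem exp_le_measure_success {α θ : ℝ} (hα : 2 < α) (hθ : 0 < θ) (hlam : 0 ≤ lam) :
    Real.exp (-(lam * (Real.pi * θ ^ (2 / α) * Real.Gamma (1 + 2 / α) *
        Real.Gamma (1 - 2 / α))))
      ≤ N.P.real {ω | ENNReal.ofReal θ < N.sir α 1 ω} := by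
  have hα0 : 0 < α := by linarith
  have hδ : 2 / α < 1 := by rw [div_lt_one hα0]; exact hα
  have hmp := measurable_pathLoss α
  have hm : Measurable fun x : Plane => logOneAdd (ENNReal.ofReal θ * pathLoss α x 0) :=
    measurable_logOneAdd.comp (measurable_const.mul hmp)
  set C := Real.pi * θ ^ (2 / α) * Real.Gamma (1 + 2 / α) * Real.Gamma (1 - 2 / α) with hC
  have hC0 : 0 ≤ C := by
    have h1 : 0 < Real.Gamma (1 + 2 / α) := Real.Gamma_pos_of_pos (by positivity)
    have h2 : 0 < Real.Gamma (1 - 2 / α) := Real.Gamma_pos_of_pos (by linarith)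
    positivity
  have hlap := N.ppp.expNeg_le_lintegral hlam hm
  simp only [expNeg_logOneAdd, lintegral_one_sub_inv_one_add_pathLoss hα hθ,
    N.lintegral_logOneAdd_countingMeasure] at hlap
  rw [← hC, ← ENNReal.ofReal_mul hlam, expNeg_ofReal (mul_nonneg hlam hC0)] at hlap
  set E : Set ((ℕ → Plane) × (Option ℕ → ℝ)) := {q | ∑' n, ENNReal.ofReal θ *
    pathLoss α (q.1 n) 0 * ENNReal.ofReal (q.2 (some n)) < ENNReal.ofReal (q.2 none)} with hE
  have hEm : MeasurableSet E := by
    refine measurableSet_lt (Measurable.tsum fun n => ?_) (by fun_prop)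
    exact (measurable_const.mul (hmp.comp (by fun_prop))).mul (by fun_prop)
  have hXm : Measurable fun ω n => N.X n ω := measurable_pi_lambda _ N.ppp.measurable
  have hhm : Measurable fun ω i => N.h i ω := measurable_pi_lambda _ N.measurable_h
  have hind : IndepFun (fun ω n => N.X n ω) (fun ω i => N.h i ω) N.P :=
    N.indep_X.comp measurable_id measurable_fst
  have hlow : ∫⁻ ω, expNeg (∑' n, logOneAdd (ENNReal.ofReal θ * pathLoss α (N.X n ω) 0)) ∂N.P
      ≤ N.P {ω | ((fun n => N.X n ω), fun i => N.h i ω) ∈ E} := by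
    have h2 : N.P {ω | ((fun n => N.X n ω), fun i => N.h i ω) ∈ E}
        = N.P.map (fun ω => ((fun n => N.X n ω), fun i => N.h i ω)) E := by
      rw [Measure.map_apply (hXm.prodMk hhm) hEm]; rfl
    rw [h2, (indepFun_iff_map_prod_eq_prod_map_map hXm.aemeasurable hhm.aemeasurable).1 hind,
      Measure.prod_apply hEm, lintegral_map (measurable_measure_prodMk_left hEm) hXm]
    refine lintegral_mono fun ω => ?_
    rw [Measure.map_apply hhm (measurable_prodMk_left hEm)]
    exact expNeg_tsum_logOneAdd_le_measure N.measurable_h N.law_h N.indep_h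
      fun n => ENNReal.ofReal θ * pathLoss α (N.X n ω) 0
  have hsub : {ω | ((fun n => N.X n ω), fun i => N.h i ω) ∈ E}
      ⊆ {ω | ENNReal.ofReal θ < N.sir α 1 ω} := by
    intro ω hω
    rw [Set.mem_ofPred_eq, N.lt_sir_iff hθ]
    refine lt_of_le_of_lt ?_ hω
    rw [interference, ← ENNReal.tsum_mul_left]
    refine ENNReal.tsum_le_tsum fun n => ?_
    split_ifs
    · rw [mul_comm (ENNReal.ofReal (N.h (some n) ω)), mul_assoc]
    · simp
  have := hlap.trans (hlow.trans (measure_mono hsub))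
  rwa [← ofReal_measureReal, ENNReal.ofReal_le_ofReal_iff measureReal_nonneg] at this

/-- When every node transmits, failure has positive conditional probability whatever the point
process: given that the first interferer is within distance `k`, it suffices that the desired
gain is small and the gain of that interferer is large. -/
theorem condSuccess_lt_one {α θ : ℝ} (hα : 0 < α) (hθ : 0 < θ) (hp : p = 1) :
    ∀ᵐ ω ∂N.P, N.condSuccess α 1 θ ω < 1 := by
  set D := {ω | ENNReal.ofReal θ < N.sir α 1 ω} with hD
  have hDm : MeasurableSet D := N.measurableSet_success α θ
  have hle := N.sigmaPhi_le
  set A := {ω | 1 ≤ N.condSuccess α 1 θ ω} with hA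
  have hAs : MeasurableSet[N.sigmaPhi] A :=
    stronglyMeasurable_condExp.measurable measurableSet_Ici
  have hAm : MeasurableSet A := hle _ hAs
  suffices hA0 : N.P A = 0 by
    filter_upwards [measure_eq_zero_iff_ae_notMem.1 hA0] with ω hω
    exact not_le.1 hω
  have hint : Integrable (D.indicator fun _ => (1 : ℝ)) N.P :=
    (integrable_const 1).indicator hDm
  -- Success is almost sure on `A`.
  have hfull : N.P (A ∩ Dᶜ) = 0 := by
    have h1 : ∫ ω in A, N.condSuccess α 1 θ ω ∂N.P = N.P.real (A ∩ D) := by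
      rw [condSuccess, setIntegral_condExp hle hint hAs, setIntegral_indicator hDm]
      simp
    have h2 : N.P.real A ≤ ∫ ω in A, N.condSuccess α 1 θ ω ∂N.P := by
      have : ∫ ω in A, (1 : ℝ) ∂N.P = N.P.real A := by simp
      rw [← this]
      exact setIntegral_mono_on (integrable_const 1).integrableOn
        integrable_condExp.integrableOn hAm fun ω hω => hω
    have h3 := measureReal_inter_add_sdiff (μ := N.P) (s := A) hDm
    rw [← Set.sdiff_eq]
    exact (measureReal_eq_zero_iff (measure_ne_top _ _)).1
      (le_antisymm (by linarith) measureReal_nonneg)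
  obtain ⟨T, hT, hTA⟩ := hAs
  have hXm : Measurable fun ω n => N.X n ω := measurable_pi_lambda _ N.ppp.measurable
  have hΦ : Measurable fun x : ℕ → Plane => Measure.sum fun n => Measure.dirac (x n) :=
    measurable_countingMeasure (X := fun n (x : ℕ → Plane) => x n) fun n => measurable_pi_apply n
  have hcover : A ⊆ ⋃ k : ℕ, A ∩ {ω | ‖N.X 0 ω‖ ≤ k} := by
    intro ω hω
    obtain ⟨k, hk⟩ := exists_nat_ge ‖N.X 0 ω‖
    exact Set.mem_iUnion.2 ⟨k, hω, hk⟩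
  refine measure_mono_null hcover (measure_iUnion_null fun k => ?_)
  set r : ℝ := k + 1 with hr
  have hr0 : 0 < r := by positivity
  set c : ℝ := θ * r ^ (-α) with hc
  have hc0 : 0 < c := by positivity
  set F := {ω | N.h none ω ≤ c} ∩ {ω | 1 < N.h (some 0) ω} with hF
  have hact : ∀ᵐ ω ∂N.P, N.active 0 ω = true := by
    have h := N.law_active 0
    exact (prob_compl_eq_zero_iff (N.measurable_active 0 (measurableSet_singleton true))).2
      (h.trans (by rw [hp, ENNReal.ofReal_one]))
  have hFpos : N.P F ≠ 0 := by
    have h1 : N.P {ω | N.h none ω ≤ c} ≠ 0 := by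
      have := isProbabilityMeasure_expMeasure one_pos
      rw [(N.law_h none).measure_eq measurableSet_Iic]
      intro h0
      have h1 : (expMeasure 1).real (Set.Iic c) = 1 - Real.exp (-c) := by
        rw [← cdf_eq_real, cdf_expMeasure_eq one_pos, if_pos hc0.le, one_mul]
      have h2 : Real.exp (-c) < 1 := by simpa using hc0
      have h3 : (expMeasure 1).real (Set.Iic c) = 0 :=
        (measureReal_eq_zero_iff (measure_ne_top _ _)).2 h0
      linarith
    have h2 : N.P {ω | 1 < N.h (some 0) ω} ≠ 0 := by
      rw [(N.law_h (some 0)).measure_eq measurableSet_Ioi]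
      have h3 := expMeasure_lt_ofReal 1
      simp only [ENNReal.one_lt_ofReal] at h3
      rw [h3, ← ENNReal.ofReal_one, expNeg_ofReal zero_le_one]
      simp [Real.exp_pos]
    have h := (N.indep_h.indepFun (i := none) (j := some 0) (by simp)).measure_inter_preimage_eq_mul
      (Set.Iic c) (Set.Ioi 1) measurableSet_Iic measurableSet_Ioi
    have h' : N.P F = N.P {ω | N.h none ω ≤ c} * N.P {ω | 1 < N.h (some 0) ω} := h
    rw [h']
    exact mul_ne_zero h1 h2
  have hindep : N.P ((A ∩ {ω | ‖N.X 0 ω‖ ≤ k}) ∩ F)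
      = N.P (A ∩ {ω | ‖N.X 0 ω‖ ≤ k}) * N.P F := by
    have h := N.indep_X.measure_inter_preimage_eq_mul
      ((fun x : ℕ → Plane => Measure.sum fun n => Measure.dirac (x n)) ⁻¹' T ∩ {x | ‖x 0‖ ≤ k})
      ({q | q.1 none ≤ c} ∩ {q | 1 < q.1 (some 0)})
      ((hΦ hT).inter (measurableSet_le (by fun_prop) measurable_const))
      ((measurableSet_le (by fun_prop) measurable_const).inter
        (measurableSet_lt measurable_const (by fun_prop)))
    rw [← hTA]
    exact h
  have hzero : N.P ((A ∩ {ω | ‖N.X 0 ω‖ ≤ k}) ∩ F) = 0 := by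
    refine measure_mono_null (t := (A ∩ Dᶜ) ∪ {ω | ¬ N.active 0 ω = true}) ?_
      (measure_union_null hfull (ae_iff.1 hact))
    rintro ω ⟨⟨hωA, hωk⟩, hω0, hω1⟩
    by_cases ha : N.active 0 ω = true
    swap
    · exact Or.inr ha
    refine Or.inl ⟨hωA, fun hωD => ?_⟩
    rw [hD, Set.mem_ofPred_eq, N.lt_sir_iff hθ] at hωD
    have hpl : ENNReal.ofReal (r ^ (-α)) ≤ pathLoss α (N.X 0 ω) 0 := by
      rw [pathLoss, edist_zero_right, ← ofReal_norm, ← ENNReal.ofReal_rpow_of_pos hr0,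
        ENNReal.rpow_neg, ENNReal.rpow_neg, ENNReal.inv_le_inv]
      have : ‖N.X 0 ω‖ ≤ r := le_trans hωk (by simp [hr])
      gcongr
    have h1 : (1 : ℝ≥0∞) ≤ ENNReal.ofReal (N.h (some 0) ω) := by
      rw [ENNReal.one_le_ofReal]; exact le_of_lt hω1
    have h2 : pathLoss α (N.X 0 ω) 0 ≤ N.interference α ω := by
      refine le_trans ?_ (ENNReal.le_tsum 0)
      rw [if_pos ha]
      exact le_mul_of_one_le_left' h1
    have h3 : ENNReal.ofReal (N.h none ω) ≤ ENNReal.ofReal θ * N.interference α ω :=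
      calc ENNReal.ofReal (N.h none ω) ≤ ENNReal.ofReal c := ENNReal.ofReal_le_ofReal hω0
        _ = ENNReal.ofReal θ * ENNReal.ofReal (r ^ (-α)) := ENNReal.ofReal_mul hθ.le
        _ ≤ _ := by gcongr; exact hpl.trans h2
    exact absurd hωD (not_lt.2 h3)
  rw [hindep] at hzero
  exact (mul_eq_zero.1 hzero).resolve_right hFpos

end BipolarNetwork

/-! ### The lower bound on the spatial outage capacity -/

theorem mainTheorem5
    (N : ∀ q : NetworkParams, BipolarNetwork.{u} q.1.1 q.1.2)
    (α θ ε δ : ℝ) (hα : 2 < α) (hδ : δ = 2 / α) (hθ : 0 < θ) (hε0 : 0 < ε) (hε1 : ε < 1) :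
    (((1 - lambertW ((1 - ε) * Real.exp 1)) /
          (Real.pi * θ ^ δ * Real.Gamma (1 + δ) * Real.Gamma (1 - δ)) *
        ((Real.exp (-(1 - lambertW ((1 - ε) * Real.exp 1))) - (1 - ε)) / ε) : ℝ) : EReal)
      < spatialOutageCapacity N α 1 θ ε := by
  obtain ⟨hw0, hw1, hw⟩ := lambertW_spec hε0 hε1
  set w := lambertW ((1 - ε) * Real.exp 1)
  have hα0 : 0 < α := by linarith
  have hδ1 : δ < 1 := by rw [hδ, div_lt_one hα0]; exact hα
  have hδ0 : 0 < δ := by rw [hδ]; positivity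
  set C := Real.pi * θ ^ δ * Real.Gamma (1 + δ) * Real.Gamma (1 - δ) with hC
  have hC0 : 0 < C := by
    have h1 : 0 < Real.Gamma (1 + δ) := Real.Gamma_pos_of_pos (by positivity)
    have h2 : 0 < Real.Gamma (1 - δ) := Real.Gamma_pos_of_pos (by linarith)
    positivity
  -- The density `s = (1 - w) / C` maximizes `s * (exp (-s C) - (1 - ε))`, as `w e ^ w = (1 - ε) e`.
  have hlam : 0 < (1 - w) / C := div_pos (by linarith) hC0
  let q : NetworkParams := ⟨((1 - w) / C, 1), hlam, one_pos, le_rfl⟩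
  refine lt_of_lt_of_le ?_ (le_iSup (fun q : NetworkParams =>
    ((q.1.1 * q.1.2 * (N q).metaDistribution α 1 θ ε : ℝ) : EReal)) q)
  rw [EReal.coe_lt_coe_iff]
  change _ < (1 - w) / C * 1 * (N q).metaDistribution α 1 θ ε
  rw [mul_one]
  refine mul_lt_mul_of_pos_left ?_ hlam
  have hle := (N q).sigmaPhi_le
  have hDm := (N q).measurableSet_success α θ
  have hmean : ∫ ω, (N q).condSuccess α 1 θ ω ∂(N q).P
      = (N q).P.real {ω | ENNReal.ofReal θ < (N q).sir α 1 ω} := by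
    rw [BipolarNetwork.condSuccess, integral_condExp hle, integral_indicator_const _ hDm]
    simp
  have hexp : Real.exp (-(1 - w)) ≤ ∫ ω, (N q).condSuccess α 1 θ ω ∂(N q).P := by
    have := (N q).exp_le_measure_success hα hθ hlam.le
    rw [← hδ, ← hC, show q.1.1 * C = 1 - w from div_mul_cancel₀ _ hC0.ne'] at this
    rwa [hmean]
  have hgt : 1 - ε < Real.exp (-(1 - w)) := by
    have h1 : w * Real.exp (-(1 - w)) = 1 - ε := by
      have he := Real.exp_ne_zero 1
      rw [neg_sub, Real.exp_sub, ← mul_div_assoc, hw, mul_div_cancel_right₀ _ he]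
    have h2 := Real.exp_pos (-(1 - w))
    nlinarith
  have hmarkov : ∫ ω, (N q).condSuccess α 1 θ ω ∂(N q).P < 1 - ε +
      (1 - (1 - ε)) * (N q).P.real {ω | 1 - ε < (N q).condSuccess α 1 θ ω} :=
    integral_lt_add_mul_measureReal (stronglyMeasurable_condExp.measurable.mono hle le_rfl)
      integrable_condExp ((N q).condSuccess_lt_one hα0 hθ rfl) (hgt.trans_le hexp)
  rw [div_lt_iff₀ hε0]
  change _ < (N q).P.real {ω | 1 - ε < (N q).condSuccess α 1 θ ω} * ε
  linarith
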